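/- For integers $x\le y$ write $[x,y]=\{x,x+1,\dots,y\}$. A cyclic interval hypergraph on $[x,y]$ is a set $\mathbb H$ of subsets of $[x,y]$ (its hyperedges) that contains every singleton $\{i\}$, $i\in[x,y]$, and each of whose other members is either regular, i.e. equal to $[i,j]$ with $x\le i<j\le y$ and different from $[x,y]$, or cyclic, i.e. equal to $[j,y]\cup[x,i]$ with $x\le i<j\le y$. The regular part $\mathbb H_{\mathrm{reg}}$ consists of the regular hyperedges together with the singletons; a family of sets is closed under intersection if it contains $H\cap H'$ whenever it contains $H$ and $H'$ and $H\cap H'\neq\emptyset$. A hugging quadruple of $\mathbb H$ consists of four distinct hyperedges $I,I_{\mathrm{cyc}},J,J_{\mathrm{cyc}}$ with $I,J$ regular, $I_{\mathrm{cyc}},J_{\mathrm{cyc}}$ cyclic, $\{x,x+1\}\subseteq I\cap I_{\mathrm{cyc}}$ and $\{y-1,y\}\subseteq J\cap J_{\mathrm{cyc}}$; a fix of it is a hyperedge $H\in\mathbb H$ with $\{x+1,y-1\}\subseteq H\subseteq I\cup I_{\mathrm{cyc}}\cup J\cup J_{\mathrm{cyc}}$. For $D=[x,y]$ put $\mathbb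 H|_D=\{H\cap D: H\in\mathbb H\}\setminus\{\emptyset\}$, a hypergraph on $[x,y]$. An orientation of $\mathbb H$ is a map $A$ assigning to each $H\in\mathbb H$ an element $A(H)\in H$. It is cyclic if there are $k\ge 2$ and hyperedges $H_1,\dots,H_k$ with $A(H_{i+1})\in H_i\setminus\{A(H_i)\}$ for $1\le i<k$ and $A(H_1)\in H_k\setminus\{A(H_k)\}$, and acyclic otherwise. The source sequence poset $P_{\mathbb H}$ is the set of acyclic orientations of $\mathbb H$, ordered by $A\le B$ iff $A(H)\le B(H)$ for all $H\in\mathbb H$. For acyclic orientations $A,B$ put $H_{AB}=\max\{A(H),B(H)\}$. For $H\in\mathbb H$ and $\ell\in H$, an $(H,\ell)$-sequence is a sequence $(H_i,h_i)_{i=1}^k$, $k\ge1$, with $H_i\in\mathbb H$ and $h_i\in H_i$, such that $H_1=H$, $h_1=\ell$, $h_i=(H_i)_{AB}$ for $i\neq 1$, $h_i\in H_{i+1}$ and $h_i<h_{i+1}$ for $1\le i<k$, and $h_k\in H$. Let $X^{AB}(H,\ell)$ be the maximum of $h_k$ over all $(H,\ell)$-sequences, and let the pseudo-join $X^{AB}$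 be the orientation $$X^{AB}(H)=\min\{X^{AB}(H,\ell) : \ell\in H,\ \ell\ge H_{AB}\}.$$ Proposition. Let $\mathbb H$ be a cyclic interval hypergraph on $[1,n]$ such that for all $1\le x<y\le n$, with $D=[x,y]$, the regular part $(\mathbb H|_D)_{\mathrm{reg}}$ is closed under intersection and every hugging quadruple of $\mathbb H|_D$ has a fix in $\mathbb H|_D$. Let $A$ and $B$ be two incomparable elements of $P_{\mathbb H}$. Then the pseudo-join $X^{AB}$ is an acyclic orientation of $\mathbb H$, and it is the least upper bound of $A$ and $B$ in $P_{\mathbb H}$. -/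

import Mathlib

/-- A regular hyperedge of a hypergraph on `[x, y]`: an interval `[i, j]` with
`x ≤ i < j ≤ y`, different from `[x, y]`. -/
def IsRegularEdge (x y : ℕ) (H : Finset ℕ) : Prop :=
  H ≠ Finset.Icc x y ∧ ∃ i j : ℕ, x ≤ i ∧ i < j ∧ j ≤ y ∧ H = Finset.Icc i j

/-- A cyclic hyperedge of a hypergraph on `[x, y]`: a set `[j, y] ∪ [x, i]` with
`x ≤ i < j ≤ y` (the case `j = i + 1` is the full set `[x, y]`). -/
def IsCyclicEdge (x y : ℕ) (H : Finset ℕ) : Prop :=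
  ∃ i j : ℕ, x ≤ i ∧ i < j ∧ j ≤ y ∧ H = Finset.Icc j y ∪ Finset.Icc x i

/-- Cyclic interval hypergraphs on `[x, y]`, with the convention that all singletons
are hyperedges. -/
structure IsCyclicIntervalHypergraph (x y : ℕ) (ℍ : Finset (Finset ℕ)) : Prop where
  singleton_mem : ∀ i ∈ Finset.Icc x y, {i} ∈ ℍ
  edge : ∀ H ∈ ℍ, (∃ i ∈ Finset.Icc x y, H = {i}) ∨ IsRegularEdge x y H ∨ IsCyclicEdge x y H

/-- The restriction `{H ∩ D | H ∈ ℍ} \ {∅}`. -/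
def restriction (ℍ : Finset (Finset ℕ)) (D : Finset ℕ) : Finset (Finset ℕ) :=
  (ℍ.image fun H => H ∩ D).erase ∅

/-- The regular part of a hypergraph on `[x, y]`, regarded again as a hypergraph on `[x, y]`.
Every hypergraph contains the singletons by convention, so those singletons that belong
to `ℍ` are kept. -/
def regularPart (x y : ℕ) (ℍ : Finset (Finset ℕ)) : Set (Finset ℕ) :=
  {H | H ∈ ℍ ∧ (IsRegularEdge x y H ∨ ∃ i ∈ Finset.Icc x y, H = {i})}

/-- A family of sets is closed under (nonempty) intersection. -/
def ClosedUnderIntersection (F : Set (Finset ℕ)) : Prop :=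
  ∀ H ∈ F, ∀ K ∈ F, (H ∩ K).Nonempty → H ∩ K ∈ F

/-- Hugging quadruples of a hypergraph on `[x, y]`. -/
structure IsHuggingQuadruple (x y : ℕ) (ℍ : Finset (Finset ℕ))
    (I Icyc J Jcyc : Finset ℕ) : Prop where
  pairwise_ne : [I, Icyc, J, Jcyc].Nodup
  I_mem : I ∈ ℍ
  I_regular : IsRegularEdge x y I
  J_mem : J ∈ ℍ
  J_regular : IsRegularEdge x y J
  Icyc_mem : Icyc ∈ ℍ
  Icyc_cyclic : IsCyclicEdge x y Icyc
  Jcyc_mem : Jcyc ∈ ℍ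
  Jcyc_cyclic : IsCyclicEdge x y Jcyc
  left_I : {x, x + 1} ⊆ I
  left_Icyc : {x, x + 1} ⊆ Icyc
  right_J : {y, y - 1} ⊆ J
  right_Jcyc : {y, y - 1} ⊆ Jcyc

/-- `H` is a fix of the quadruple `I, Icyc, J, Jcyc` in the hypergraph `ℍ` on `[x, y]`. -/
def IsFix (x y : ℕ) (ℍ : Finset (Finset ℕ)) (I Icyc J Jcyc H : Finset ℕ) : Prop :=
  H ∈ ℍ ∧ {x + 1, y - 1} ⊆ H ∧ H ⊆ I ∪ Icyc ∪ J ∪ Jcyc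

/-- An orientation of `ℍ` picks a source in each hyperedge. -/
@[ext]
structure HyperOrientation (ℍ : Finset (Finset ℕ)) where
  source : {H // H ∈ ℍ} → ℕ
  source_mem : ∀ H, source H ∈ H.1

namespace HyperOrientation

variable {ℍ : Finset (Finset ℕ)}

/-- There are hyperedges `S 0, …, S (k + 1)` such that the source of `S (i + 1)` lies in `S i`
and differs from the source of `S i`; indices are taken modulo `k + 2`, so the last condition
relates `S 0` to `S (k + 1)`. -/
def IsCyclic (A : HyperOrientation ℍ) : Prop :=
  ∃ (k : ℕ) (S : Fin (k + 2) → {H // H ∈ ℍ}),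
    ∀ i, A.source (S (i + 1)) ∈ (S i).1 \ {A.source (S i)}

def IsAcyclic (A : HyperOrientation ℍ) : Prop := ¬ A.IsCyclic

end HyperOrientation

/-- The ground set of the source sequence poset of `ℍ`. -/
def AcyclicOrientation (ℍ : Finset (Finset ℕ)) : Type :=
  {A : HyperOrientation ℍ // A.IsAcyclic}

/-- The source sequence poset: `A ≤ B` iff `A(H) ≤ B(H)` for every hyperedge `H`. -/
instance AcyclicOrientation.instPartialOrder (ℍ : Finset (Finset ℕ)) : PartialOrder (AcyclicOrientation ℍ) :=
  PartialOrder.lift (fun A => A.1.source)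
    (fun _ _ h => Subtype.ext (HyperOrientation.ext h))

namespace HyperOrientation

variable {ℍ : Finset (Finset ℕ)}

/-- `H_{AB} = max {A(H), B(H)}`. -/
def maxSource (A B : HyperOrientation ℍ) (H : {H // H ∈ ℍ}) : ℕ :=
  max (A.source H) (B.source H)

/-- `(E 0, h 0), …, (E k, h k)` is an `(H, ℓ)`-sequence with respect to `A` and `B`. -/
structure IsJoinSequence (A B : HyperOrientation ℍ) (H : {H // H ∈ ℍ}) (ℓ : ℕ) (k : ℕ)
    (E : Fin (k + 1) → {H // H ∈ ℍ}) (h : Fin (k + 1) → ℕ) : Prop where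
  mem : ∀ i, h i ∈ (E i).1
  edge_zero : E 0 = H
  value_zero : h 0 = ℓ
  value : ∀ i, i ≠ 0 → h i = maxSource A B (E i)
  step_mem : ∀ i : Fin k, h i.castSucc ∈ (E i.succ).1
  step_lt : ∀ i : Fin k, h i.castSucc < h i.succ
  last_mem : h (Fin.last k) ∈ H.1

/-- The set of final values of `(H, ℓ)`-sequences. -/
def joinValues (A B : HyperOrientation ℍ) (H : {H // H ∈ ℍ}) (ℓ : ℕ) : Set ℕ :=
  {m | ∃ (k : ℕ) (E : Fin (k + 1) → {H // H ∈ ℍ}) (h : Fin (k + 1) → ℕ),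
    IsJoinSequence A B H ℓ k E h ∧ h (Fin.last k) = m}

/-- `X^{AB}(H, ℓ)`, the maximum of the final values of `(H, ℓ)`-sequences. -/
noncomputable def pseudoJoinFrom (A B : HyperOrientation ℍ) (H : {H // H ∈ ℍ}) (ℓ : ℕ) : ℕ :=
  sSup (joinValues A B H ℓ)

theorem pseudoJoinFrom_isGreatest (A B : HyperOrientation ℍ) (H : {H // H ∈ ℍ}) {ℓ : ℕ}
    (hℓ : ℓ ∈ H.1) : IsGreatest (joinValues A B H ℓ) (pseudoJoinFrom A B H ℓ) := by
  have hne : (joinValues A B H ℓ).Nonempty :=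
    ⟨ℓ, 0, fun _ => H, fun _ => ℓ,
      ⟨fun _ => hℓ, rfl, rfl, fun i hi => absurd (Fin.ext (by omega)) hi,
        fun i => i.elim0, fun i => i.elim0, hℓ⟩, rfl⟩
  have hbd : BddAbove (joinValues A B H ℓ) := by
    refine ⟨H.1.sup id, ?_⟩
    rintro m ⟨k, E, h, hs, rfl⟩
    exact Finset.le_sup (f := id) hs.last_mem
  exact ⟨Nat.sSup_mem hne hbd, fun m hm => le_csSup hbd hm⟩

/-- The set of the values `X^{AB}(H, ℓ)` for `ℓ ∈ H`, `ℓ ≥ H_{AB}`. -/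
def pseudoJoinCandidates (A B : HyperOrientation ℍ) (H : {H // H ∈ ℍ}) : Set ℕ :=
  {m | ∃ ℓ ∈ H.1, maxSource A B H ≤ ℓ ∧ m = pseudoJoinFrom A B H ℓ}

/-- `X^{AB}(H)`, the minimum of the values `X^{AB}(H, ℓ)` for `ℓ ∈ H`, `ℓ ≥ H_{AB}`. -/
noncomputable def pseudoJoinSource (A B : HyperOrientation ℍ) (H : {H // H ∈ ℍ}) : ℕ :=
  sInf (pseudoJoinCandidates A B H)

theorem pseudoJoinSource_isLeast (A B : HyperOrientation ℍ) (H : {H // H ∈ ℍ}) :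
    IsLeast (pseudoJoinCandidates A B H) (pseudoJoinSource A B H) := by
  have hmem : maxSource A B H ∈ H.1 := by
    rcases max_choice (A.source H) (B.source H) with h | h
    · rw [maxSource, h]; exact A.source_mem H
    · rw [maxSource, h]; exact B.source_mem H
  have hne : (pseudoJoinCandidates A B H).Nonempty := ⟨_, _, hmem, le_rfl, rfl⟩
  exact ⟨Nat.sInf_mem hne, fun m hm => Nat.sInf_le hm⟩

/-- The pseudo-join `X^{AB}`, as an orientation. -/
noncomputable def pseudoJoin (A B : HyperOrientation ℍ) : HyperOrientation ℍ where
  source := pseudoJoinSource A B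
  source_mem H := by
    obtain ⟨ℓ, hℓ, -, he⟩ := (pseudoJoinSource_isLeast A B H).1
    obtain ⟨k, E, h, hs, hl⟩ := (pseudoJoinFrom_isGreatest A B H hℓ).1
    rw [he, ← hl]
    exact hs.last_mem

end HyperOrientation

/-! A join step goes from a vertex `a` up to a source `maxSource A B K > a` with `a ∈ K`, so `(H,
ℓ)`-sequences are chains of join steps that end in `H`. Call `ℓ ∈ H` terminal if no nonempty chain
from `ℓ` ends in `H`. The pseudo-join picks the least terminal vertex of `H` that is at least
`maxSource A B H`. In particular it lies above `A` and `B`. Acyclicity of an orientation is used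
through rankings of the vertices for which each source has the strictly largest rank in its
hyperedge.

Leastness: if an acyclic `C` lies above `A` and `B`, then `C(H)` is itself terminal in `H`
(`not_transGen_source`), so the pseudo-join is at most `C(H)`. Closure under intersection enters
here: it supplies a hyperedge inside two crossing arcs on which `C` would fall below `A` or `B`.

Acyclicity: a shortest closed walk of sources has no chords. For length at least three, an arc
missing a point between two of its members contains everything outside them; with chordlessness this
forces the sources, read from the least one, to be monotone, and both directions are impossible.
Length two is where fixes are needed (`no_mutual_source_step`): extremal choices produce a hugging
quadruple, and its fix contradicts one of them. -/

/-! ### Arc families and their traces on intervals -/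

/-- The combinatorial content of being a family of arcs of the circle `1, …, n`: a hyperedge
that misses a point between two of its members contains everything outside these members. -/
structure IsArcFamily (n : ℕ) (ℍ : Finset (Finset ℕ)) : Prop where
  bounds : ∀ H ∈ ℍ, ∀ t ∈ H, 1 ≤ t ∧ t ≤ n
  below : ∀ H ∈ ℍ, ∀ p q r : ℕ, p ∈ H → r ∈ H → q ∉ H → p < q → q < r →
    ∀ t, 1 ≤ t → t ≤ p → t ∈ H
  above : ∀ H ∈ ℍ, ∀ p q r : ℕ, p ∈ H → r ∈ H → q ∉ H → p < q → q < r →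
    ∀ t, r ≤ t → t ≤ n → t ∈ H

theorem IsCyclicIntervalHypergraph.isArcFamily {n : ℕ} {ℍ : Finset (Finset ℕ)}
    (h : IsCyclicIntervalHypergraph 1 n ℍ) : IsArcFamily n ℍ := by
  refine ⟨fun H hH t ht => ?_, fun H hH p q r hp hr hq hpq hqr t ht htp => ?_,
    fun H hH p q r hp hr hq hpq hqr t ht htp => ?_⟩ <;>
  · rcases h.edge H hH with ⟨i, hi, rfl⟩ | ⟨-, i, j, hi, hij, hj, rfl⟩ | ⟨i, j, hi, hij, hj, rfl⟩ <;>
      simp only [Finset.mem_singleton, Finset.mem_union, Finset.mem_Icc] at * <;> omega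

/-- In an arc family, the trace on `[x, y]` of a hyperedge with two points in `[x, y]` that
misses one of the endpoints is a regular hyperedge. -/
theorem IsArcFamily.isRegularEdge {n : ℕ} {ℍ : Finset (Finset ℕ)} (h : IsArcFamily n ℍ)
    {H : Finset ℕ} (hH : H ∈ ℍ) {x y p q : ℕ} (hx : 1 ≤ x) (hy : y ≤ n) (hxp : x ≤ p)
    (hpq : p < q) (hqy : q ≤ y) (hp : p ∈ H) (hq : q ∈ H) (hxy : x ∉ H ∨ y ∉ H) :
    IsRegularEdge x y (H ∩ Finset.Icc x y) := by
  have hne : (H ∩ Finset.Icc x y).Nonempty := ⟨p, by simp [hp]; omega⟩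
  have hp' : p ∈ H ∩ Finset.Icc x y := by simp [hp]; omega
  have hq' : q ∈ H ∩ Finset.Icc x y := by simp [hq]; omega
  have hmin := Finset.min'_mem _ hne
  have hmax := Finset.max'_mem _ hne
  have h1 := Finset.min'_le _ _ hp'
  have h2 := Finset.le_max' _ _ hq'
  have hlo : ∀ t ∈ H ∩ Finset.Icc x y, (H ∩ Finset.Icc x y).min' hne ≤ t :=
    fun t ht => Finset.min'_le _ _ ht
  have hhi : ∀ t ∈ H ∩ Finset.Icc x y, t ≤ (H ∩ Finset.Icc x y).max' hne :=
    fun t ht => Finset.le_max' _ _ ht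
  generalize (H ∩ Finset.Icc x y).min' hne = i at *
  generalize (H ∩ Finset.Icc x y).max' hne = j at *
  simp only [Finset.mem_inter, Finset.mem_Icc] at hmin hmax
  refine ⟨fun he => ?_, i, j, hmin.2.1, by omega, hmax.2.2, ?_⟩
  · have hxm : x ∈ H ∩ Finset.Icc x y := by rw [he]; simp; omega
    have hym : y ∈ H ∩ Finset.Icc x y := by rw [he]; simp; omega
    rw [Finset.mem_inter] at hxm hym
    tauto
  · ext t
    constructor
    · intro ht
      exact Finset.mem_Icc.2 ⟨hlo t ht, hhi t ht⟩
    · intro ht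
      rw [Finset.mem_Icc] at ht
      rw [Finset.mem_inter, Finset.mem_Icc]
      refine ⟨?_, by omega, by omega⟩
      by_contra hn
      have hti : t ≠ i := by rintro rfl; exact hn hmin.1
      have htj : t ≠ j := by rintro rfl; exact hn hmax.1
      have hb := h.below H hH i t j hmin.1 hmax.1 hn (by omega) (by omega) x hx (by omega)
      have ha := h.above H hH i t j hmin.1 hmax.1 hn (by omega) (by omega) y (by omega) hy
      tauto

/-- In an arc family, the trace on `[x, y]` of a hyperedge through `x` and `y` is cyclic. -/
theorem IsArcFamily.isCyclicEdge {n : ℕ} {ℍ : Finset (Finset ℕ)} (h : IsArcFamily n ℍ)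
    {H : Finset ℕ} (hH : H ∈ ℍ) {x y : ℕ} (hxy : x < y) (hx : x ∈ H) (hy : y ∈ H) :
    IsCyclicEdge x y (H ∩ Finset.Icc x y) := by
  have hb := h.bounds H hH
  by_cases hc : ∃ c ∉ H, x < c ∧ c < y
  · obtain ⟨c, hc, hxc, hcy⟩ := hc
    have hl : (H.filter (· < c)).Nonempty := ⟨x, by simp [hx, hxc]⟩
    have hr : (H.filter (c < ·)).Nonempty := ⟨y, by simp [hy, hcy]⟩
    have h1 := Finset.max'_mem _ hl
    have h2 := Finset.min'_mem _ hr
    have h3 : ∀ t ∈ H.filter (· < c), t ≤ (H.filter (· < c)).max' hl :=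
      fun t ht => Finset.le_max' _ _ ht
    have h4 : ∀ t ∈ H.filter (c < ·), (H.filter (c < ·)).min' hr ≤ t :=
      fun t ht => Finset.min'_le _ _ ht
    generalize (H.filter (· < c)).max' hl = i at *
    generalize (H.filter (c < ·)).min' hr = j at *
    simp only [Finset.mem_filter] at h1 h2 h3 h4
    have hxi := h3 x ⟨hx, hxc⟩
    have hjy := h4 y ⟨hy, hcy⟩
    refine ⟨i, j, hxi, by omega, hjy, ?_⟩
    ext t
    simp only [Finset.mem_inter, Finset.mem_union, Finset.mem_Icc]
    constructor
    · rintro ⟨ht, ht1, ht2⟩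
      rcases lt_trichotomy t c with h5 | rfl | h5
      · exact Or.inr ⟨ht1, h3 t ⟨ht, h5⟩⟩
      · exact absurd ht hc
      · exact Or.inl ⟨h4 t ⟨ht, h5⟩, ht2⟩
    · rintro (⟨h5, h6⟩ | ⟨h5, h6⟩)
      · exact ⟨h.above H hH i c j h1.1 h2.1 hc h1.2 h2.2 t h5 (by have := hb y hy; omega),
          by omega, h6⟩
      · exact ⟨h.below H hH i c j h1.1 h2.1 hc h1.2 h2.2 t (by have := hb x hx; omega) h6,
          h5, by omega⟩
  · push Not at hc
    refine ⟨x, x + 1, le_rfl, by omega, hxy, ?_⟩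
    ext t
    simp only [Finset.mem_inter, Finset.mem_union, Finset.mem_Icc]
    constructor
    · rintro ⟨-, h1, h2⟩; omega
    · intro ht
      refine ⟨?_, by omega, by omega⟩
      by_contra hn
      have h1 : x < t := by
        rcases Nat.lt_or_ge x t with h1 | h1
        · exact h1
        · exact absurd (by rwa [show t = x by omega]) hn
      have h2 := hc t hn h1
      exact hn (by rwa [show t = y by omega])

theorem mem_restriction {ℍ : Finset (Finset ℕ)} {D K : Finset ℕ} :
    K ∈ restriction ℍ D ↔ K.Nonempty ∧ ∃ H ∈ ℍ, H ∩ D = K := by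
  simp [restriction, Finset.nonempty_iff_ne_empty]

theorem inter_mem_restriction {ℍ : Finset (Finset ℕ)} {D H : Finset ℕ} (hH : H ∈ ℍ) {t : ℕ}
    (ht : t ∈ H) (htD : t ∈ D) : H ∩ D ∈ restriction ℍ D :=
  mem_restriction.2 ⟨⟨t, Finset.mem_inter.2 ⟨ht, htD⟩⟩, H, hH, rfl⟩

theorem exists_greatest_of_bounded {P : ℕ → Prop} {N : ℕ} (hN : ∀ m, P m → m ≤ N)
    (hP : ∃ m, P m) : ∃ m, P m ∧ ∀ k, P k → k ≤ m := by
  classical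
  obtain ⟨m, hm⟩ := hP
  exact ⟨Nat.findGreatest P N, Nat.findGreatest_spec (hN m hm) hm,
    fun k hk => Nat.le_findGreatest (hN k hk) hk⟩

/-! ### Rankings from acyclic orientations -/

section Ranking

variable {ℍ : Finset (Finset ℕ)}

/-- `r` ranks the vertices so that `σ` picks the vertex of largest rank in each hyperedge. -/
structure IsRanking (σ : {H // H ∈ ℍ} → ℕ) (r : ℕ → ℕ) : Prop where
  mem : ∀ H, σ H ∈ H.1
  lt : ∀ H, ∀ t ∈ H.1, t ≠ σ H → r t < r (σ H)

/-- The source of `K` is a member of `H` other than the source of `H`. -/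
def SourceStep (σ : {H // H ∈ ℍ} → ℕ) (H K : {H // H ∈ ℍ}) : Prop :=
  σ K ∈ H.1 ∧ σ K ≠ σ H

theorem exists_path_of_transGen {α : Type*} {R : α → α → Prop} {a b : α}
    (h : Relation.TransGen R a b) :
    ∃ (k : ℕ) (S : ℕ → α), S 0 = a ∧ S (k + 1) = b ∧ ∀ i ≤ k, R (S i) (S (i + 1)) := by
  induction h with
  | single h => exact ⟨0, fun i => if i = 0 then a else _, by simp, by simp; rfl, by simpa using h⟩
  | @tail b c _ hbc ih =>
    obtain ⟨k, S, h0, hk, hS⟩ := ih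
    refine ⟨k + 1, fun i => if i ≤ k + 1 then S i else c, by simpa using h0, by simp,
      fun i hi => ?_⟩
    rcases Nat.lt_or_ge i (k + 1) with h1 | h1
    · simpa [show i ≤ k + 1 by omega, show i ≤ k by omega] using hS i (by omega)
    · obtain rfl : i = k + 1 := by omega
      simpa [hk] using hbc

theorem HyperOrientation.IsAcyclic.not_transGen {A : HyperOrientation ℍ} (hA : A.IsAcyclic)
    (H : {H // H ∈ ℍ}) : ¬ Relation.TransGen (SourceStep A.source) H H := by
  intro h
  obtain ⟨k, S, h0, hk, hS⟩ := exists_path_of_transGen h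
  -- A closed walk of length one contradicts the inequality in `SourceStep`; `IsCyclic` asks for at
  -- least two hyperedges.
  rcases k with _ | k
  · have := hS 0 le_rfl
    rw [zero_add] at hk
    rw [zero_add, h0, hk] at this
    exact this.2 rfl
  · refine hA ⟨k, fun i => S i.1, fun i => ?_⟩
    have h1 : S ((i + 1 : Fin (k + 2)) : ℕ) = S (i.1 + 1) := by
      rcases eq_or_ne i (Fin.last (k + 1)) with rfl | hi
      · simp [h0, hk]
      · rw [Fin.val_add_one_of_lt (Fin.lt_last_iff_ne_last.2 hi)]
    have h2 := hS i.1 (by omega)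
    beta_reduce
    rw [h1, Finset.mem_sdiff, Finset.mem_singleton]
    exact h2

theorem HyperOrientation.IsAcyclic.exists_isRanking {A : HyperOrientation ℍ} (hA : A.IsAcyclic) :
    ∃ r, IsRanking A.source r := by
  classical
  let dom : ℕ → ℕ → Prop := fun a b => ∃ H, A.source H = a ∧ b ∈ H.1 ∧ b ≠ a
  have key : ∀ a b, Relation.TransGen dom a b →
      ∃ H, A.source H = a ∧ ∀ K, A.source K = b →
        Relation.TransGen (SourceStep A.source) H K := by
    intro a b h
    induction h with
    | single h =>
      obtain ⟨H, rfl, hb, hne⟩ := h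
      exact ⟨H, rfl, fun K hK => .single ⟨hK ▸ hb, hK ▸ hne⟩⟩
    | tail _ h ih =>
      obtain ⟨H, hH, hHK⟩ := ih
      obtain ⟨H', rfl, hb, hne⟩ := h
      exact ⟨H, hH, fun K hK => (hHK H' rfl).tail ⟨hK ▸ hb, hK ▸ hne⟩⟩
  have irr : ∀ a, ¬ Relation.TransGen dom a a := by
    intro a h
    obtain ⟨H, hH, hHK⟩ := key a a h
    exact hA.not_transGen H (hHK H hH)
  have hfin : ∀ a, {b | Relation.TransGen dom a b}.Finite := by
    intro a
    refine (ℍ.biUnion id).finite_toSet.subset fun b hb => ?_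
    obtain ⟨c, -, H, -, hbH, -⟩ := Relation.TransGen.tail'_iff.1 hb
    exact Finset.mem_coe.2 (Finset.mem_biUnion.2 ⟨H.1, H.2, hbH⟩)
  -- The rank of a vertex is the number of vertices it dominates transitively. Passing from a source
  -- to another member of its hyperedge loses that member, by irreflexivity.
  refine ⟨fun a => {b | Relation.TransGen dom a b}.ncard, A.source_mem, fun H t ht hne => ?_⟩
  have hd : dom (A.source H) t := ⟨H, rfl, ht, hne⟩
  refine Set.ncard_lt_ncard ⟨fun b hb => Relation.TransGen.head hd hb, fun hs => ?_⟩ (hfin _)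
  exact irr t (hs (Relation.TransGen.single hd))

end Ranking

/-! ### Join steps and terminal vertices -/

namespace HyperOrientation

variable {ℍ : Finset (Finset ℕ)} {A B : HyperOrientation ℍ}

theorem maxSource_mem (A B : HyperOrientation ℍ) (H : {H // H ∈ ℍ}) : maxSource A B H ∈ H.1 := by
  rcases max_choice (A.source H) (B.source H) with h | h
  · rw [maxSource, h]; exact A.source_mem H
  · rw [maxSource, h]; exact B.source_mem H

/-- One step of an `(H, ℓ)`-sequence. -/
def JoinStep (A B : HyperOrientation ℍ) (a b : ℕ) : Prop :=
  a < b ∧ ∃ K : {H // H ∈ ℍ}, a ∈ K.1 ∧ maxSource A B K = b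

theorem JoinStep.lt_of_transGen {a b : ℕ} (h : Relation.TransGen (JoinStep A B) a b) : a < b := by
  induction h with
  | single h => exact h.1
  | tail _ h ih => exact ih.trans h.1

theorem JoinStep.le_of_reflTransGen {a b : ℕ} (h : Relation.ReflTransGen (JoinStep A B) a b) :
    a ≤ b := by
  induction h with
  | refl => exact le_rfl
  | tail _ h ih => exact ih.trans h.1.le

/-- A chain of steps from `s` to `t` has a step across each `w` with `s ≤ w < t`. -/
theorem JoinStep.exists_crossing {s t w : ℕ} (h : Relation.ReflTransGen (JoinStep A B) s t)
    (hs : s ≤ w) (ht : w < t) :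
    ∃ p q, Relation.ReflTransGen (JoinStep A B) s p ∧ JoinStep A B p q ∧
      Relation.ReflTransGen (JoinStep A B) q t ∧ p ≤ w ∧ w < q := by
  induction h with
  | refl => omega
  | @tail b c hb hbc ih =>
    rcases Nat.lt_or_ge w b with h1 | h1
    · obtain ⟨p, q, h2, h3, h4, h5⟩ := ih h1
      exact ⟨p, q, h2, h3, h4.tail hbc, h5⟩
    · exact ⟨b, c, hb, hbc, .refl, h1, ht⟩

theorem mem_joinValues {H : {H // H ∈ ℍ}} {ℓ m : ℕ} (hℓ : ℓ ∈ H.1) :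
    m ∈ joinValues A B H ℓ ↔ m ∈ H.1 ∧ Relation.ReflTransGen (JoinStep A B) ℓ m := by
  constructor
  · rintro ⟨k, E, h, hs, rfl⟩
    refine ⟨hs.last_mem, ?_⟩
    have key : ∀ i : Fin (k + 1), Relation.ReflTransGen (JoinStep A B) ℓ (h i) := by
      intro i
      induction i using Fin.induction with
      | zero => rw [hs.value_zero]
      | succ i ih =>
        exact ih.tail ⟨hs.step_lt i, E i.succ, hs.step_mem i,
          (hs.value i.succ (Fin.succ_ne_zero i)).symm⟩
    exact key _
  · rintro ⟨hm, h⟩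
    have key : ∃ (k : ℕ) (E : Fin (k + 1) → {H // H ∈ ℍ}) (f : Fin (k + 1) → ℕ),
        (∀ i, f i ∈ (E i).1) ∧ E 0 = H ∧ f 0 = ℓ ∧ (∀ i, i ≠ 0 → f i = maxSource A B (E i)) ∧
        (∀ i : Fin k, f i.castSucc ∈ (E i.succ).1) ∧ (∀ i : Fin k, f i.castSucc < f i.succ) ∧
        f (Fin.last k) = m := by
      clear hm
      induction h with
      | refl =>
        exact ⟨0, fun _ => H, fun _ => ℓ, fun _ => hℓ, rfl, rfl,
          fun i hi => absurd (Fin.ext (by omega)) hi, fun i => i.elim0, fun i => i.elim0, rfl⟩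
      | @tail b c _ hbc ih =>
        obtain ⟨k, E, f, h1, h2, h3, h4, h5, h6, h7⟩ := ih
        obtain ⟨hlt, K, hbK, rfl⟩ := hbc
        refine ⟨k + 1, Fin.snoc E K, Fin.snoc f (maxSource A B K), fun i => ?_, ?_, ?_,
          fun i hi => ?_, fun i => ?_, fun i => ?_, by simp⟩
        · induction i using Fin.lastCases with
          | last => simpa using maxSource_mem A B K
          | cast i => simpa using h1 i
        · rw [← Fin.castSucc_zero, Fin.snoc_castSucc, h2]
        · rw [← Fin.castSucc_zero, Fin.snoc_castSucc, h3]
        · induction i using Fin.lastCases with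
          | last => simp
          | cast i => simpa using h4 i (by rintro rfl; exact hi rfl)
        · induction i using Fin.lastCases with
          | last => simpa [h7] using hbK
          | cast i =>
            rw [Fin.succ_castSucc, Fin.snoc_castSucc, Fin.snoc_castSucc]
            exact h5 i
        · induction i using Fin.lastCases with
          | last => simpa [h7] using hlt
          | cast i =>
            rw [Fin.succ_castSucc, Fin.snoc_castSucc, Fin.snoc_castSucc]
            exact h6 i
    obtain ⟨k, E, f, h1, h2, h3, h4, h5, h6, rfl⟩ := key
    exact ⟨k, E, f, ⟨h1, h2, h3, h4, h5, h6, hm⟩, rfl⟩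

theorem maxSource_le_pseudoJoinSource (A B : HyperOrientation ℍ) (H : {H // H ∈ ℍ}) :
    maxSource A B H ≤ pseudoJoinSource A B H := by
  obtain ⟨ℓ, hℓ, hle, he⟩ := (pseudoJoinSource_isLeast A B H).1
  rw [he]
  exact hle.trans ((pseudoJoinFrom_isGreatest A B H hℓ).2 ((mem_joinValues hℓ).2 ⟨hℓ, .refl⟩))

theorem pseudoJoinSource_mem (A B : HyperOrientation ℍ) (H : {H // H ∈ ℍ}) :
    pseudoJoinSource A B H ∈ H.1 := (pseudoJoin A B).source_mem H

/-- The chosen value is the largest end in `H` of chains from some `ℓ`; a further chain back to `H`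
would extend one of these to a larger end. -/
theorem not_transGen_pseudoJoinSource {H : {H // H ∈ ℍ}} {z : ℕ} (hz : z ∈ H.1) :
    ¬ Relation.TransGen (JoinStep A B) (pseudoJoinSource A B H) z := by
  intro h
  have hlt := JoinStep.lt_of_transGen h
  obtain ⟨ℓ, hℓ, hle, he⟩ := (pseudoJoinSource_isLeast A B H).1
  have hg := pseudoJoinFrom_isGreatest A B H hℓ
  rw [← he] at hg
  have := hg.2 ((mem_joinValues hℓ).2
    ⟨hz, ((mem_joinValues hℓ).1 hg.1).2.trans h.to_reflTransGen⟩)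
  omega

theorem exists_transGen_of_lt_pseudoJoinSource {H : {H // H ∈ ℍ}} {ℓ : ℕ} (hℓ : ℓ ∈ H.1)
    (hle : maxSource A B H ≤ ℓ) (hlt : ℓ < pseudoJoinSource A B H) :
    ∃ z ∈ H.1, Relation.TransGen (JoinStep A B) ℓ z := by
  have h1 := (pseudoJoinSource_isLeast A B H).2 ⟨ℓ, hℓ, hle, rfl⟩
  have hg := (mem_joinValues hℓ).1 (pseudoJoinFrom_isGreatest A B H hℓ).1
  refine ⟨_, hg.1, ?_⟩
  rcases Relation.reflTransGen_iff_eq_or_transGen.1 hg.2 with h2 | h2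
  · omega
  · exact h2

/-- Each value of `maxSource` is attained by a ranked family of sources below `maxSource`. -/
theorem exists_isRanking_maxSource (hA : A.IsAcyclic) (hB : B.IsAcyclic) (N : {H // H ∈ ℍ}) :
    ∃ σ r, IsRanking (ℍ := ℍ) σ r ∧ (∀ H, σ H ≤ maxSource A B H) ∧ σ N = maxSource A B N := by
  rcases max_choice (A.source N) (B.source N) with h | h
  · obtain ⟨r, hr⟩ := hA.exists_isRanking
    exact ⟨A.source, r, hr, fun H => le_max_left _ _, h.symm⟩
  · obtain ⟨r, hr⟩ := hB.exists_isRanking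
    exact ⟨B.source, r, hr, fun H => le_max_right _ _, h.symm⟩

end HyperOrientation

/-! ### Comparison with other upper bounds -/

namespace HyperOrientation

variable {n : ℕ} {ℍ : Finset (Finset ℕ)} {A B : HyperOrientation ℍ}

/-- An arc of the family is contained in the intersection of two crossing arcs and has the
same trace between their ends. -/
theorem exists_mem_inter (hℍ : IsArcFamily n ℍ)
    (hreg : ∀ x y : ℕ, 1 ≤ x → x < y → y ≤ n →
      ClosedUnderIntersection (regularPart x y (restriction ℍ (Finset.Icc x y))))
    {H K : Finset ℕ} (hH : H ∈ ℍ) (hK : K ∈ ℍ) {a p q c : ℕ} (hap : a < p) (hpq : p < q)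
    (hqc : q < c) (haH : a ∈ H) (hpH : p ∈ H) (hqH : q ∈ H) (hcH : c ∉ H) (haK : a ∉ K)
    (hpK : p ∈ K) (hqK : q ∈ K) (hcK : c ∈ K) :
    ∃ L ∈ ℍ, L ⊆ H ∩ K ∧ p ∈ L ∧ q ∈ L := by
  have ha1 := (hℍ.bounds H hH a haH).1
  have hcn := (hℍ.bounds K hK c hcK).2
  have hpD : p ∈ Finset.Icc a c := Finset.mem_Icc.2 ⟨by omega, by omega⟩
  have hqD : q ∈ Finset.Icc a c := Finset.mem_Icc.2 ⟨by omega, by omega⟩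
  have h1 := hreg a c ha1 (by omega) hcn (H ∩ Finset.Icc a c)
    ⟨inter_mem_restriction hH hpH hpD, Or.inl (hℍ.isRegularEdge hH ha1 hcn hap.le hpq hqc.le
      hpH hqH (Or.inr hcH))⟩ (K ∩ Finset.Icc a c)
    ⟨inter_mem_restriction hK hpK hpD, Or.inl (hℍ.isRegularEdge hK ha1 hcn hap.le hpq hqc.le
      hpK hqK (Or.inl haK))⟩ ⟨p, by simp only [Finset.mem_inter]; tauto⟩
  obtain ⟨-, L, hL, he⟩ := mem_restriction.1 h1.1
  have hmem : ∀ t, a ≤ t → t ≤ c → (t ∈ L ↔ t ∈ H ∧ t ∈ K) := by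
    intro t h2 h3
    have h4 : t ∈ L ∩ Finset.Icc a c ↔ t ∈ (H ∩ Finset.Icc a c) ∩ (K ∩ Finset.Icc a c) := by
      rw [he]
    simp only [Finset.mem_inter, Finset.mem_Icc] at h4
    tauto
  have hpL := (hmem p (by omega) (by omega)).2 ⟨hpH, hpK⟩
  have hqL := (hmem q (by omega) (by omega)).2 ⟨hqH, hqK⟩
  have haL : a ∉ L := fun h => haK ((hmem a le_rfl (by omega)).1 h).2
  have hcL : c ∉ L := fun h => hcH ((hmem c (by omega) le_rfl).1 h).1
  -- A point of `L` outside `[a, c]` would make `L` wrap around and contain `c` or `a`, but it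
  -- misses both.
  refine ⟨L, hL, fun t ht => ?_, hpL, hqL⟩
  have hat : a ≤ t := by
    by_contra h
    exact hcL (hℍ.above L hL t a p ht hpL haL (by omega) hap c (by omega) hcn)
  have htc : t ≤ c := by
    by_contra h
    exact haL (hℍ.below L hL q c t hqL ht hcL hqc (by omega) a ha1 (by omega))
  exact Finset.mem_inter.2 ((hmem t hat htc).1 ht)

/-- Let the step come from `K`, with `σ` whichever of `A`, `B` has source `b` in `K`. If `b ∈ H`,
the rankings give `σ H ∉ K` and `τ K ∉ H`, so `H` and `K` cross over `τ H < b`. A hyperedge `L ⊆ H ∩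
K` through both points then has `σ L = b > τ H = τ L`, against `σ ≤ τ`. -/
theorem not_mem_of_joinStep_source (hℍ : IsArcFamily n ℍ)
    (hreg : ∀ x y : ℕ, 1 ≤ x → x < y → y ≤ n →
      ClosedUnderIntersection (regularPart x y (restriction ℍ (Finset.Icc x y))))
    (hA : A.IsAcyclic) (hB : B.IsAcyclic) {τ : {H // H ∈ ℍ} → ℕ} {s : ℕ → ℕ}
    (hτ : IsRanking τ s) (hle : ∀ K, maxSource A B K ≤ τ K) {H : {H // H ∈ ℍ}} {b : ℕ}
    (hb : JoinStep A B (τ H) b) : b ∉ H.1 := by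
  intro hbH
  obtain ⟨hlt, K, hℓK, hKb⟩ := hb
  obtain ⟨σ, r, hσ, hσle, hσK⟩ := exists_isRanking_maxSource hA hB K
  rw [hKb] at hσK
  have hbK : b ∈ K.1 := hσK ▸ hσ.mem K
  have haℓ : σ H ≤ τ H := (hσle H).trans (hle H)
  have hbc : b ≤ τ K := hKb ▸ hle K
  have haK : σ H ∉ K.1 := by
    intro h
    have h1 := hσ.lt K _ h (by omega)
    have h2 := hσ.lt H b hbH (by omega)
    rw [hσK] at h1
    omega
  have hcH : τ K ∉ H.1 := by
    intro h
    have h1 := hτ.lt H _ h (by omega)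
    have h2 := hτ.lt K _ hℓK (by omega)
    omega
  have hne1 : σ H ≠ τ H := fun h => haK (h ▸ hℓK)
  have hne2 : b ≠ τ K := fun h => hcH (h ▸ hbH)
  obtain ⟨L, hL, hsub, hℓL, hbL⟩ := exists_mem_inter hℍ hreg H.2 K.2 (by omega) hlt (by omega)
    (hσ.mem H) (hτ.mem H) hbH hcH haK hℓK hbK (hτ.mem K)
  have h1 : σ ⟨L, hL⟩ = b := by
    by_contra hne
    have h1 := hσ.lt ⟨L, hL⟩ b hbL (Ne.symm hne)
    have h2 := hσ.lt K _ (Finset.mem_inter.1 (hsub (hσ.mem ⟨L, hL⟩))).2 (by rwa [hσK])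
    rw [hσK] at h2
    omega
  have h2 : τ ⟨L, hL⟩ = τ H := by
    by_contra hne
    have h1 := hτ.lt ⟨L, hL⟩ (τ H) hℓL (Ne.symm hne)
    have h2 := hτ.lt H _ (Finset.mem_inter.1 (hsub (hτ.mem ⟨L, hL⟩))).1 hne
    omega
  have h3 := (hσle ⟨L, hL⟩).trans (hle ⟨L, hL⟩)
  omega

theorem not_transGen_source (hℍ : IsArcFamily n ℍ)
    (hreg : ∀ x y : ℕ, 1 ≤ x → x < y → y ≤ n →
      ClosedUnderIntersection (regularPart x y (restriction ℍ (Finset.Icc x y))))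
    (hA : A.IsAcyclic) (hB : B.IsAcyclic) {τ : {H // H ∈ ℍ} → ℕ} {s : ℕ → ℕ}
    (hτ : IsRanking τ s) (hle : ∀ K, maxSource A B K ≤ τ K) {H : {H // H ∈ ℍ}} {v : ℕ}
    (hv : v ∈ H.1) : ¬ Relation.TransGen (JoinStep A B) (τ H) v := by
  intro h
  -- Everything reached from `τ H` has, at or above it, a vertex `c` outranking `τ H`. Since `c`
  -- cannot lie in `H`, while the first step leaves `H`, returning at `v` would force `H` to contain
  -- all vertices above `v`, including `c`.
  have key : ∀ v, Relation.TransGen (JoinStep A B) (τ H) v →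
      ∃ c, v ≤ c ∧ c ≤ n ∧ s (τ H) < s c := by
    have base : ∀ (K : {H // H ∈ ℍ}), τ H ∈ K.1 → τ H < maxSource A B K →
        ∃ c, maxSource A B K ≤ c ∧ c ≤ n ∧ s (τ H) < s c := by
      intro K hK hlt
      have := hle K
      exact ⟨τ K, hle K, (hℍ.bounds K.1 K.2 _ (hτ.mem K)).2, hτ.lt K _ hK (by omega)⟩
    intro v h
    induction h with
    | single h =>
      obtain ⟨hlt, K, hK, rfl⟩ := h
      exact base K hK hlt
    | @tail u w hu huw ih =>
      have hℓu := JoinStep.lt_of_transGen hu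
      obtain ⟨hlt, K, hK, rfl⟩ := huw
      by_cases hℓK : τ H ∈ K.1
      · exact base K hℓK (hℓu.trans hlt)
      · obtain ⟨c, huc, hcn, hs⟩ := ih
        rcases Nat.lt_or_ge c (maxSource A B K) with h1 | h1
        -- If `K` missed `c` it would wrap around and contain `τ H`.
        · have hcK : c ∈ K.1 := by
            by_contra hc
            have hne : u ≠ c := fun h => hc (h ▸ hK)
            exact hℓK (hℍ.below K.1 K.2 u c _ hK (maxSource_mem A B K) hc (by omega) h1 _
              (hℍ.bounds H.1 H.2 _ (hτ.mem H)).1 hℓu.le)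
          have h2 := hle K
          have h3 := hτ.lt K c hcK (by omega)
          exact ⟨τ K, h2, (hℍ.bounds K.1 K.2 _ (hτ.mem K)).2, hs.trans h3⟩
        · exact ⟨c, h1, hcn, hs⟩
  obtain ⟨c, hvc, hcn, hs⟩ := key v h
  have hcH : c ∉ H.1 := by
    intro hc
    have := hτ.lt H c hc (by rintro rfl; omega)
    omega
  obtain ⟨w, hw, hwv⟩ := Relation.TransGen.head'_iff.1 h
  have hwH := not_mem_of_joinStep_source hℍ hreg hA hB hτ hle hw
  have hle' := JoinStep.le_of_reflTransGen hwv
  have hne : w ≠ v := fun h => hwH (h ▸ hv)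
  exact hcH (hℍ.above H.1 H.2 _ w v (hτ.mem H) hv hwH hw.1 (by omega) c hvc hcn)

theorem pseudoJoinSource_le (hℍ : IsArcFamily n ℍ)
    (hreg : ∀ x y : ℕ, 1 ≤ x → x < y → y ≤ n →
      ClosedUnderIntersection (regularPart x y (restriction ℍ (Finset.Icc x y))))
    (hA : A.IsAcyclic) (hB : B.IsAcyclic) {C : HyperOrientation ℍ} (hC : C.IsAcyclic)
    (hle : ∀ K, maxSource A B K ≤ C.source K) (H : {H // H ∈ ℍ}) :
    pseudoJoinSource A B H ≤ C.source H := by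
  obtain ⟨s, hs⟩ := hC.exists_isRanking
  by_contra h
  obtain ⟨z, hz, hz'⟩ :=
    exists_transGen_of_lt_pseudoJoinSource (C.source_mem H) (hle H) (not_le.1 h)
  exact not_transGen_source hℍ hreg hA hB hs hle hz hz'

/-! ### Jumps over a source of the pseudo-join -/

/-- If the pseudo-join picks `b` in `K`, each smaller `a ∈ K` either leads to `b` or leads to a
hyperedge that jumps over `b`. -/
theorem transGen_or_jump (hℍ : IsArcFamily n ℍ) (hA : A.IsAcyclic) (hB : B.IsAcyclic)
    {K : {H // H ∈ ℍ}} {a b : ℕ} (hb : pseudoJoinSource A B K = b) (ha : a ∈ K.1) (hab : a < b) :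
    Relation.TransGen (JoinStep A B) a b ∨
      ∃ (u v z : ℕ) (N : {H // H ∈ ℍ}), Relation.ReflTransGen (JoinStep A B) a u ∧
        u < b ∧ b < v ∧ v < z ∧ z ∈ K.1 ∧ v ∉ K.1 ∧ b ∉ N.1 ∧ u ∈ N.1 ∧
        maxSource A B N = v ∧ Relation.ReflTransGen (JoinStep A B) v z ∧ maxSource A B K ≤ u := by
  obtain ⟨a', ⟨haK, haa', hle⟩, hmax⟩ := exists_greatest_of_bounded
    (P := fun m => m ∈ K.1 ∧ Relation.ReflTransGen (JoinStep A B) a m ∧ m ≤ b)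
    (fun m h => h.2.2) ⟨a, ha, .refl, hab.le⟩
  have hbK : b ∈ K.1 := hb ▸ pseudoJoinSource_mem A B K
  have hMb : maxSource A B K ≤ b := hb ▸ maxSource_le_pseudoJoinSource A B K
  rcases eq_or_lt_of_le hle with rfl | hlt
  · rcases Relation.reflTransGen_iff_eq_or_transGen.1 haa' with h | h
    · omega
    · exact Or.inl h
  right
  -- Otherwise `K` itself gives a join step from `a'` to a larger vertex of `K` that is at most `b`.
  have hM : maxSource A B K ≤ a' := by
    by_contra h
    have := hmax _ ⟨maxSource_mem A B K,
      haa'.tail ⟨not_le.1 h, K, haK, rfl⟩, hMb⟩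
    omega
  obtain ⟨z, hz, haz⟩ := exists_transGen_of_lt_pseudoJoinSource haK hM (hb.symm ▸ hlt)
  have hbz : b < z := by
    by_contra h
    have h1 := hmax z ⟨hz, haa'.trans haz.to_reflTransGen, not_lt.1 h⟩
    have h2 := JoinStep.lt_of_transGen haz
    omega
  have hclosed : ∀ v, JoinStep A B b v → ¬ Relation.ReflTransGen (JoinStep A B) v z := by
    intro v h1 h2
    exact not_transGen_pseudoJoinSource hz (hb.symm ▸ Relation.TransGen.head' h1 h2)
  obtain ⟨u, v, hau, ⟨huv, N, huN, hNv⟩, hvz, hub, hbv⟩ :=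
    JoinStep.exists_crossing haz.to_reflTransGen hlt.le hbz
  have hbN : b ∉ N.1 := fun h => hclosed v ⟨hbv, N, h, hNv⟩ hvz
  have hub' : u < b := lt_of_le_of_ne hub fun h => hbN (h ▸ huN)
  have hau' := JoinStep.le_of_reflTransGen hau
  -- If `v ∈ K`, then `σ K` and `v = σ N` both lie in `K ∩ N`, and each would outrank the other.
  have hvK : v ∉ K.1 := by
    intro hvK
    obtain ⟨σ, r, hσ, hσle, hσN⟩ := exists_isRanking_maxSource hA hB N
    rw [hNv] at hσN
    have h1 := hσle K
    have h2 : σ K ∈ N.1 := hℍ.below N.1 N.2 u b v huN (hσN ▸ hσ.mem N) hbN hub' hbv _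
      (hℍ.bounds K.1 K.2 _ (hσ.mem K)).1 (by omega)
    have h3 := hσ.lt K v hvK (by omega)
    have h4 := hσ.lt N _ h2 (by omega)
    rw [hσN] at h4
    omega
  have hvz' : v ≠ z := fun h => hvK (h ▸ hz)
  have := JoinStep.le_of_reflTransGen hvz
  exact ⟨u, v, z, N, haa'.trans hau, hub', hbv, by omega, hz, hvK, hbN, huN, hNv, hvz, by omega⟩

end HyperOrientation

/-! ### Excluding cycles of length two -/

namespace HyperOrientation

variable {n : ℕ} {ℍ : Finset (Finset ℕ)} {A B : HyperOrientation ℍ}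

/-- The vertex `w` lies above `b` and leads to a vertex of `K` above `b`. -/
def LeadsAbove (A B : HyperOrientation ℍ) (K : {H // H ∈ ℍ}) (b w : ℕ) : Prop :=
  b < w ∧ ∃ z ∈ K.1, Relation.ReflTransGen (JoinStep A B) w z

/-- The hyperedge `N` passes through `a`, misses `b`, and its largest source leads to a vertex
of `K` above `b`. -/
def IsJump (A B : HyperOrientation ℍ) (K : {H // H ∈ ℍ}) (a b : ℕ) (N : {H // H ∈ ℍ}) : Prop :=
  a ∈ N.1 ∧ b ∉ N.1 ∧ LeadsAbove A B K b (maxSource A B N)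

theorem isHuggingQuadruple_of_arcs (hℍ : IsArcFamily n ℍ) {H K J N : Finset ℕ} (hH : H ∈ ℍ)
    (hK : K ∈ ℍ) (hJ : J ∈ ℍ) (hN : N ∈ ℍ) {x y v : ℕ} (hxv : x < v) (hvy : v < y)
    (hxH : x ∈ H) (hxH' : x + 1 ∈ H) (hyH : y ∉ H) (hxK : x ∈ K) (hxK' : x + 1 ∈ K) (hyK : y ∈ K)
    (hvK : v ∉ K) (hxJ : x ∉ J) (hyJ' : y - 1 ∈ J) (hyJ : y ∈ J) (hxN : x ∈ N) (hvN : v ∈ N)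
    (hyN' : y - 1 ∈ N) (hyN : y ∈ N) :
    IsHuggingQuadruple x y (restriction ℍ (Finset.Icc x y)) (H ∩ Finset.Icc x y)
      (K ∩ Finset.Icc x y) (J ∩ Finset.Icc x y) (N ∩ Finset.Icc x y) := by
  have hx1 := (hℍ.bounds H hH x hxH).1
  have hyn := (hℍ.bounds K hK y hyK).2
  have dx : x ∈ Finset.Icc x y := Finset.mem_Icc.2 ⟨by omega, by omega⟩
  have dx' : x + 1 ∈ Finset.Icc x y := Finset.mem_Icc.2 ⟨by omega, by omega⟩
  have dy : y ∈ Finset.Icc x y := Finset.mem_Icc.2 ⟨by omega, by omega⟩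
  have dy' : y - 1 ∈ Finset.Icc x y := Finset.mem_Icc.2 ⟨by omega, by omega⟩
  have dv : v ∈ Finset.Icc x y := Finset.mem_Icc.2 ⟨by omega, by omega⟩
  have hne : ∀ {P Q : Finset ℕ} {t : ℕ}, t ∈ Finset.Icc x y → t ∈ P → t ∉ Q →
      P ∩ Finset.Icc x y ≠ Q ∩ Finset.Icc x y := by
    intro P Q t ht hP hQ he
    have : t ∈ Q ∩ Finset.Icc x y := he ▸ Finset.mem_inter.2 ⟨hP, ht⟩
    exact hQ (Finset.mem_inter.1 this).1
  have hpair : ∀ {P : Finset ℕ} {s t : ℕ}, s ∈ P → t ∈ P → s ∈ Finset.Icc x y →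
      t ∈ Finset.Icc x y → {s, t} ⊆ P ∩ Finset.Icc x y := by
    intro P s t h1 h2 h3 h4 w hw
    rcases Finset.mem_insert.1 hw with rfl | hw
    · exact Finset.mem_inter.2 ⟨h1, h3⟩
    · rw [Finset.mem_singleton.1 hw]; exact Finset.mem_inter.2 ⟨h2, h4⟩
  refine
    { pairwise_ne := ?_
      I_mem := inter_mem_restriction hH hxH dx
      I_regular := hℍ.isRegularEdge hH hx1 hyn le_rfl (Nat.lt_succ_self x) (by omega) hxH hxH'
        (Or.inr hyH)
      J_mem := inter_mem_restriction hJ hyJ dy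
      J_regular := hℍ.isRegularEdge hJ hx1 hyn (by omega) (by omega) le_rfl hyJ' hyJ (Or.inl hxJ)
      Icyc_mem := inter_mem_restriction hK hxK dx
      Icyc_cyclic := hℍ.isCyclicEdge hK (by omega) hxK hyK
      Jcyc_mem := inter_mem_restriction hN hxN dx
      Jcyc_cyclic := hℍ.isCyclicEdge hN (by omega) hxN hyN
      left_I := hpair hxH hxH' dx dx'
      left_Icyc := hpair hxK hxK' dx dx'
      right_J := hpair hyJ hyJ' dy dy'
      right_Jcyc := hpair hyN hyN' dy dy' }
  have h1 := (hne dy hyK hyH).symm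
  have h2 := hne dx hxH hxJ
  have h3 := (hne dy hyN hyH).symm
  have h4 := hne dx hxK hxJ
  have h5 := (hne dv hvN hvK).symm
  have h6 := (hne dx hxN hxJ).symm
  simp [h1, h2, h3, h4, h5, h6]

/-- The source `b` of `K₀` is jumped over by some `N` through `a`. Choose a jump reaching `e < b` as
far right as possible, then with largest target `v`, then the nearest return `y > v` of a hyperedge
through `e` and `e + 1` ranked below `v`. On `[e, y]` these give a hugging quadruple, whose fix
either extends `e` or returns at `y - 1`. -/
theorem no_mutual_source_step (hℍ : IsArcFamily n ℍ)
    (hfix : ∀ x y : ℕ, 1 ≤ x → x < y → y ≤ n → ∀ I Icyc J Jcyc : Finset ℕ,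
      IsHuggingQuadruple x y (restriction ℍ (Finset.Icc x y)) I Icyc J Jcyc →
        ∃ H, IsFix x y (restriction ℍ (Finset.Icc x y)) I Icyc J Jcyc H)
    (hA : A.IsAcyclic) (hB : B.IsAcyclic) {H K₀ : {H // H ∈ ℍ}} {a b : ℕ}
    (ha : pseudoJoinSource A B H = a) (hb : pseudoJoinSource A B K₀ = b) (hab : a < b)
    (haK : a ∈ K₀.1) (hbH : b ∈ H.1) : False := by
  have haH : a ∈ H.1 := ha ▸ pseudoJoinSource_mem A B H
  have hbK : b ∈ K₀.1 := hb ▸ pseudoJoinSource_mem A B K₀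
  have hMH : maxSource A B H ≤ a := ha ▸ maxSource_le_pseudoJoinSource A B H
  have hacl : ∀ z ∈ H.1, ¬ Relation.TransGen (JoinStep A B) a z :=
    fun z hz => ha ▸ not_transGen_pseudoJoinSource hz
  have hbcl : ∀ w, LeadsAbove A B K₀ b w → ¬ JoinStep A B b w := by
    rintro w ⟨-, z, hz, hwz⟩ h
    exact not_transGen_pseudoJoinSource hz (hb.symm ▸ Relation.TransGen.head' h hwz)
  -- The first jump over `b` starts at `a`.
  obtain ⟨hMK, N₁, hN₁⟩ : maxSource A B K₀ ≤ a ∧ ∃ N, IsJump A B K₀ a b N := by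
    rcases transGen_or_jump hℍ hA hB hb haK hab with
      h | ⟨u, v, z, N, hau, hub, hbv, hvz, hz, hvK, hbN, huN, hNv, hvz', hMK⟩
    · exact absurd h (hacl b hbH)
    have hau' := JoinStep.le_of_reflTransGen hau
    have huH : u ∈ H.1 := by
      by_contra hu
      have hne : a ≠ u := fun h => hu (h ▸ haH)
      have hzH := hℍ.above H.1 H.2 a u b haH hbH hu (by omega) hub z (by omega)
        (hℍ.bounds _ K₀.2 z hz).2
      exact hacl z hzH (Relation.TransGen.trans_right hau
        (Relation.TransGen.head' ⟨by omega, N, huN, hNv⟩ hvz'))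
    rcases Relation.reflTransGen_iff_eq_or_transGen.1 hau with rfl | h
    · exact ⟨hMK, N, huN, hbN, hNv.symm ▸ ⟨hbv, z, hz, hvz'⟩⟩
    · exact absurd h (hacl u huH)
  -- A jump reaching as far towards `b` as possible, then with the largest target.
  obtain ⟨e, ⟨heb, N₂, hN₂, heN₂⟩, hemax⟩ := exists_greatest_of_bounded
    (P := fun e => e < b ∧ ∃ N : {H // H ∈ ℍ}, IsJump A B K₀ a b N ∧ e ∈ N.1)
    (fun m h => h.1.le) ⟨a, hab, N₁, hN₁, hN₁.1⟩
  obtain ⟨v, ⟨N, ⟨haN, hbN, hNgood⟩, heN, hNv⟩, hvmax⟩ := exists_greatest_of_bounded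
    (P := fun v => ∃ N : {H // H ∈ ℍ}, IsJump A B K₀ a b N ∧ e ∈ N.1 ∧ maxSource A B N = v)
    (N := n) (by rintro _ ⟨N, -, -, rfl⟩; exact (hℍ.bounds _ N.2 _ (maxSource_mem A B N)).2)
    ⟨_, N₂, hN₂, heN₂, rfl⟩
  have hae : a ≤ e := hemax a ⟨hab, N₁, hN₁, hN₁.1⟩
  have ha1 := (hℍ.bounds _ H.2 a haH).1
  rw [hNv] at hNgood
  obtain ⟨hbv, z₀, hz₀, hvz₀⟩ := hNgood
  have hvN : v ∈ N.1 := hNv ▸ maxSource_mem A B N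
  have hNbelow : ∀ t, 1 ≤ t → t ≤ e → t ∈ N.1 := hℍ.below _ N.2 e b v heN hvN hbN heb hbv
  have hNabove : ∀ t, v ≤ t → t ≤ n → t ∈ N.1 := hℍ.above _ N.2 e b v heN hvN hbN heb hbv
  obtain ⟨σ, r, hσ, hσle, hσN⟩ := exists_isRanking_maxSource hA hB N
  rw [hNv] at hσN
  have hrN : ∀ t ∈ N.1, t ≠ v → r t < r v := by
    intro t ht hne
    have := hσ.lt N t ht (by rwa [hσN])
    rwa [hσN] at this
  have hrank : ∀ K : {H // H ∈ ℍ}, r (σ K) < r v → ∀ t ∈ K.1, r t < r v := by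
    intro K hK t ht
    by_cases h : t = σ K
    · rwa [h]
    · exact (hσ.lt K t ht h).trans hK
  -- Such a `K` has `σ K ≤ a ≤ e`, and `N` contains everything up to `e`; thus `σ K` is outranked by
  -- `v = σ N`.
  have hrlow : ∀ K : {H // H ∈ ℍ}, maxSource A B K ≤ a → ∀ t ∈ K.1, r t < r v := by
    intro K hK
    have := hσle K
    exact hrank K (hrN _ (hNbelow _ (hℍ.bounds _ K.2 _ (hσ.mem K)).1 (by omega)) (by omega))
  have hvK₀ : v ∉ K₀.1 := fun h => lt_irrefl _ (hrlow K₀ hMK v h)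
  have hvH : v ∉ H.1 := fun h => lt_irrefl _ (hrlow H hMH v h)
  have hvz : v < z₀ :=
    lt_of_le_of_ne (JoinStep.le_of_reflTransGen hvz₀) fun h => hvK₀ (h ▸ hz₀)
  have hz₀n := (hℍ.bounds _ K₀.2 z₀ hz₀).2
  have hK₀below := hℍ.below _ K₀.2 b v z₀ hbK hz₀ hvK₀ hbv hvz
  have hK₀above := hℍ.above _ K₀.2 b v z₀ hbK hz₀ hvK₀ hbv hvz
  have hHmem : ∀ t, a ≤ t → t ≤ b → t ∈ H.1 := by
    intro t h1 h2
    by_contra ht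
    have hta : a ≠ t := fun h => ht (h ▸ haH)
    have htb : t ≠ b := fun h => ht (h ▸ hbH)
    exact hvH (hℍ.above _ H.2 a t b haH hbH ht (by omega) (by omega) v (by omega) (by omega))
  have haz₀ : Relation.TransGen (JoinStep A B) a z₀ :=
    Relation.TransGen.head' ⟨by omega, N, haN, hNv⟩ hvz₀
  -- Every vertex from `v` on leads to `K₀`.
  have hgood : ∀ w, v ≤ w → w ≤ n → LeadsAbove A B K₀ b w := by
    intro w hvw hwn
    refine ⟨by omega, ?_⟩
    rcases Nat.lt_or_ge w z₀ with hw | hw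
    · obtain ⟨p, q, hvp, ⟨hpq, J, hpJ, hJq⟩, hqz, hpw, hwq⟩ :=
        JoinStep.exists_crossing hvz₀ hvw hw
      have hvp' := JoinStep.le_of_reflTransGen hvp
      have hqJ : q ∈ J.1 := hJq ▸ maxSource_mem A B J
      by_cases hwJ : w ∈ J.1
      · exact ⟨z₀, hz₀, Relation.ReflTransGen.head ⟨hwq, J, hwJ, hJq⟩ hqz⟩
      · have hne : p ≠ w := fun h => hwJ (h ▸ hpJ)
        have hbJ := hℍ.below _ J.2 p w q hpJ hqJ hwJ (by omega) hwq b (by omega) (by omega)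
        exact absurd ⟨by omega, J, hbJ, hJq⟩ (hbcl q ⟨by omega, z₀, hz₀, hqz⟩)
    · exact ⟨w, hK₀above w hw hwn, .refl⟩
  -- The hyperedge through `e`, `e + 1` and all below `v` in rank that returns earliest.
  have hex : ∃ y, v < y ∧ ∃ K : {H // H ∈ ℍ}, e ∈ K.1 ∧ e + 1 ∈ K.1 ∧ y ∈ K.1 ∧
      ∀ t ∈ K.1, r t < r v :=
    ⟨z₀, hvz, K₀, hK₀below e (by omega) (by omega), hK₀below _ (by omega) (by omega), hz₀,
      hrlow K₀ hMK⟩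
  classical
  obtain ⟨y, ⟨hvy, K, heK, heK', hyK, hrK⟩, hymin⟩ : ∃ y, (v < y ∧ ∃ K : {H // H ∈ ℍ},
      e ∈ K.1 ∧ e + 1 ∈ K.1 ∧ y ∈ K.1 ∧ ∀ t ∈ K.1, r t < r v) ∧
      ∀ m, m < y → ¬ (v < m ∧ ∃ K : {H // H ∈ ℍ},
      e ∈ K.1 ∧ e + 1 ∈ K.1 ∧ m ∈ K.1 ∧ ∀ t ∈ K.1, r t < r v) :=
    ⟨Nat.find hex, Nat.find_spec hex, fun m hm => Nat.find_min hex hm⟩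
  have hyz₀ : y ≤ z₀ := by
    by_contra h
    exact hymin z₀ (by omega) ⟨hvz, K₀, hK₀below e (by omega) (by omega),
      hK₀below _ (by omega) (by omega), hz₀, hrlow K₀ hMK⟩
  have hyn := (hℍ.bounds _ K.2 y hyK).2
  have hvK : v ∉ K.1 := fun h => lt_irrefl _ (hrK v h)
  have hyH : y ∉ H.1 := fun h => hacl z₀
    (hℍ.above _ H.2 b v y hbH h hvH hbv hvy z₀ hyz₀ hz₀n) haz₀
  -- Crossing `y - 1` means `p ≤ y - 1` and `y ≤ q`, so `J` contains both `y - 1` and `y`.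
  obtain ⟨p, q, hvp, ⟨hpq, J, hpJ, hJq⟩, hqz, hpy, hyq⟩ :=
    JoinStep.exists_crossing (w := y - 1) hvz₀ (by omega) (by omega)
  have hvp' := JoinStep.le_of_reflTransGen hvp
  have hqJ : q ∈ J.1 := hJq ▸ maxSource_mem A B J
  have hqgood : LeadsAbove A B K₀ b q := ⟨by omega, z₀, hz₀, hqz⟩
  have hbJ : b ∉ J.1 := fun h => hbcl q hqgood ⟨by omega, J, h, hJq⟩
  -- Otherwise `J` is a jump through `e` with target `q > v`, against the choice of `v`.
  have heJ : e ∉ J.1 := by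
    intro h
    have haJ := hℍ.below _ J.2 e b p h hpJ hbJ heb (by omega) a ha1 hae
    have := hvmax q ⟨J, ⟨haJ, hbJ, hJq.symm ▸ hqgood⟩, h, hJq⟩
    omega
  have hJmem : ∀ s ∈ J.1, ∀ t ∈ J.1, e ≤ s → ∀ w, s ≤ w → w ≤ t → w ∈ J.1 := by
    intro s hs t ht hes w hsw hwt
    by_contra hw
    have h1 : s ≠ w := fun h => hw (h ▸ hs)
    have h2 : w ≠ t := fun h => hw (h ▸ ht)
    exact heJ (hℍ.below _ J.2 s w t hs ht hw (by omega) (by omega) e (by omega) hes)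
  obtain ⟨F₀, hF₀, hFmem, hFsub⟩ := hfix e y (by omega) (by omega) hyn _ _ _ _
    (isHuggingQuadruple_of_arcs hℍ H.2 K.2 J.2 N.2 (by omega) hvy (hHmem e hae heb.le)
      (hHmem _ (by omega) heb) hyH heK heK' hyK hvK heJ
      (hJmem p hpJ q hqJ (by omega) _ hpy (by omega))
      (hJmem p hpJ q hqJ (by omega) _ (by omega) (by omega)) heN hvN
      (hNabove _ (by omega) (by omega)) (hNabove _ (by omega) hyn))
  obtain ⟨-, F, hF, rfl⟩ := mem_restriction.1 hF₀
  lift F to {H // H ∈ ℍ} using hF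
  have heF : e + 1 ∈ F.1 := (Finset.mem_inter.1 (hFmem (by simp))).1
  have hyF : y - 1 ∈ F.1 := (Finset.mem_inter.1 (hFmem (by simp))).1
  have hMF := maxSource_mem A B F
  -- If `b ∈ F`, terminality of `b` forbids this; if `b ∉ F`, then `F` is a jump through `e + 1`,
  -- against the choice of `e`.
  have hFgood : ¬ LeadsAbove A B K₀ b (maxSource A B F) := by
    intro h
    by_cases hbF : b ∈ F.1
    · exact hbcl _ h ⟨h.1, F, hbF, rfl⟩
    · have hne : e + 1 ≠ b := fun h => hbF (h ▸ heF)
      have haF := hℍ.below _ F.2 (e + 1) b _ heF hMF hbF (by omega) h.1 a ha1 (by omega)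
      have := hemax (e + 1) ⟨by omega, F, ⟨haF, hbF, h⟩, heF⟩
      omega
  have hMFv : maxSource A B F < v := by
    by_contra h
    exact hFgood (hgood _ (not_lt.1 h) (hℍ.bounds _ F.2 _ hMF).2)
  have hσF := hσle F
  have hrF : ∀ t ∈ F.1, r t < r v := by
    refine hrank F ?_
    rcases Nat.lt_or_ge e (σ F) with h1 | h1
    · have h2 := hFsub (Finset.mem_inter.2
        ⟨hσ.mem F, Finset.mem_Icc.2 ⟨h1.le, by omega⟩⟩)
      simp only [Finset.mem_union, Finset.mem_inter] at h2
      rcases h2 with ((⟨h2, -⟩ | ⟨h2, -⟩) | ⟨h2, -⟩) | ⟨h2, -⟩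
      · exact hrlow H hMH _ h2
      · exact hrK _ h2
      · exfalso
        have hbM : b < maxSource A B F := by
          by_contra h
          exact hbJ (hJmem _ h2 p hpJ h1.le b (by omega) (by omega))
        have hMJ := hJmem _ h2 p hpJ h1.le (maxSource A B F) hσF (by omega)
        exact hFgood ⟨hbM, z₀, hz₀, Relation.ReflTransGen.head ⟨by omega, J, hMJ, hJq⟩ hqz⟩
      · exact hrN _ h2 (by omega)
    · exact hrN _ (hNbelow _ (hℍ.bounds _ F.2 _ (hσ.mem F)).1 h1) (by omega)
  have hvF : v ∉ F.1 := fun h => lt_irrefl _ (hrF v h)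
  have hvy' : v ≠ y - 1 := fun h => hvF (h ▸ hyF)
  -- `F` misses `v`, so it wraps around and contains `e`: it returns before `y`.
  exact hymin (y - 1) (by omega) ⟨by omega, F,
    hℍ.below _ F.2 (e + 1) v (y - 1) heF hyF hvF (by omega) (by omega) e (by omega) (by omega),
    heF, hyF, hrF⟩

end HyperOrientation

/-! ### Shortest closed walks of sources -/

section SourceCycle

variable {ℍ : Finset (Finset ℕ)}

/-- A closed walk of length `k` for `SourceStep`, as a periodic sequence. -/
structure IsSourceCycle (σ : {H // H ∈ ℍ} → ℕ) (k : ℕ) (S : ℕ → {H // H ∈ ℍ}) : Prop where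
  periodic : ∀ i, S (i + k) = S i
  step : ∀ i, SourceStep σ (S i) (S (i + 1))

theorem IsSourceCycle.of_path {σ : {H // H ∈ ℍ} → ℕ} {k : ℕ} {T : ℕ → {H // H ∈ ℍ}} (hk : 0 < k)
    (h : ∀ i, i + 1 < k → SourceStep σ (T i) (T (i + 1))) (hl : SourceStep σ (T (k - 1)) (T 0)) :
    IsSourceCycle σ k fun i => T (i % k) := by
  refine ⟨fun i => by simp, fun i => ?_⟩
  have hi := Nat.mod_lt i hk
  rcases Nat.lt_or_ge (i % k + 1) k with h1 | h1
  · have : (i + 1) % k = i % k + 1 := by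
      rw [Nat.add_mod, Nat.mod_eq_of_lt (a := 1) (by omega), Nat.mod_eq_of_lt h1]
    simpa only [this] using h _ h1
  · have h2 : i % k = k - 1 := by omega
    have : (i + 1) % k = 0 := by
      rw [← Nat.mod_add_mod, h2, Nat.sub_add_cancel hk, Nat.mod_self]
    simpa only [this, h2] using hl

theorem IsSourceCycle.shift {σ : {H // H ∈ ℍ} → ℕ} {k : ℕ} {S : ℕ → {H // H ∈ ℍ}}
    (h : IsSourceCycle σ k S) (m : ℕ) : IsSourceCycle σ k fun i => S (i + m) :=
  ⟨fun i => by rw [add_right_comm]; exact h.periodic _,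
    fun i => by simpa only [add_right_comm] using h.step (i + m)⟩

/-- A shortest closed walk has no chords. -/
theorem IsSourceCycle.not_mem_of_minimal {σ : {H // H ∈ ℍ} → ℕ} {k : ℕ} {S : ℕ → {H // H ∈ ℍ}}
    (h : IsSourceCycle σ k S) (hmin : ∀ k' < k, 0 < k' → ∀ T, ¬ IsSourceCycle σ k' T)
    {i d : ℕ} (hd : 2 ≤ d) (hdk : d < k) : σ (S (i + d)) ∉ (S i).1 := by
  intro hmem
  -- With equal sources the walk from `i` already closes after `d` steps. Otherwise the chord
  -- replaces `d` steps by one, leaving length `k - d + 1`.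
  by_cases he : σ (S (i + d)) = σ (S i)
  · refine hmin d hdk (by omega) _
      (IsSourceCycle.of_path (T := fun j => S (i + j)) (by omega) (fun j _ => h.step _) ?_)
    have h1 := h.step (i + (d - 1))
    rw [show i + (d - 1) + 1 = i + d by omega] at h1
    simpa only [SourceStep, he, add_zero] using h1
  · refine hmin (k - d + 1) (by omega) (by omega) _ (IsSourceCycle.of_path
      (T := fun j => if j = 0 then S i else S (i + d + (j - 1))) (by omega) (fun j hj => ?_) ?_)
    · rcases j with _ | j
      · simpa using ⟨hmem, he⟩
      · simpa [add_assoc] using h.step (i + d + j)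
    · have h1 := h.step (i + (k - 1))
      rw [show i + (k - 1) + 1 = i + k by omega, h.periodic] at h1
      simp only [Nat.add_sub_cancel, show k - d ≠ 0 by omega, if_false, if_true]
      rwa [show i + d + (k - d - 1) = i + (k - 1) by omega]

/-- A closed walk `S 0, …, S (k - 1)` without chords. -/
structure IsChordlessCycle (σ : {H // H ∈ ℍ} → ℕ) (k : ℕ) (S : ℕ → {H // H ∈ ℍ}) : Prop where
  mem_succ : ∀ i, i + 1 < k → σ (S (i + 1)) ∈ (S i).1
  mem_last : σ (S 0) ∈ (S (k - 1)).1
  not_mem : ∀ i j, i < k → j < k → j ≠ i → j ≠ i + 1 → (i + 1 = k → j ≠ 0) → σ (S j) ∉ (S i).1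

theorem IsSourceCycle.isChordlessCycle {σ : {H // H ∈ ℍ} → ℕ} {k : ℕ} {S : ℕ → {H // H ∈ ℍ}}
    (h : IsSourceCycle σ k S) (hk : 0 < k)
    (hmin : ∀ k' < k, 0 < k' → ∀ T, ¬ IsSourceCycle σ k' T) : IsChordlessCycle σ k S := by
  refine ⟨fun i _ => (h.step i).1, ?_, fun i j hi hj h1 h2 h3 => ?_⟩
  · have h1 := (h.step (k - 1)).1
    rwa [show k - 1 + 1 = 0 + k by omega, h.periodic] at h1
  · rcases Nat.lt_or_ge i j with hij | hij
    · have := h.not_mem_of_minimal hmin (i := i) (d := j - i) (by omega) (by omega)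
      rwa [show i + (j - i) = j by omega] at this
    · have := h.not_mem_of_minimal hmin (i := i) (d := j + k - i) (by omega) (by omega)
      rwa [show i + (j + k - i) = j + k by omega, h.periodic] at this

end SourceCycle

/-! ### Excluding longer cycles -/

namespace HyperOrientation

variable {n : ℕ} {ℍ : Finset (Finset ℕ)} {A B : HyperOrientation ℍ}

/-- Each source leads to the preceding one, since a jump would make `S i` wrap around and create a
chord or break terminality in `S (k - 1)`. The composite chain from the last source to the first
ends in `S (k - 1)`, contradicting terminality. -/
theorem not_isChordlessCycle_of_decreasing (hℍ : IsArcFamily n ℍ) (hA : A.IsAcyclic)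
    (hB : B.IsAcyclic) {k : ℕ} (hk : 3 ≤ k) {S : ℕ → {H // H ∈ ℍ}}
    (hS : IsChordlessCycle (pseudoJoinSource A B) k S)
    (hanti : ∀ i j, i < j → j < k → pseudoJoinSource A B (S j) < pseudoJoinSource A B (S i)) :
    False := by
  have hmem := fun i => pseudoJoinSource_mem A B (S i)
  have hcl : ∀ i, ∀ z ∈ (S i).1,
      ¬ Relation.TransGen (JoinStep A B) (pseudoJoinSource A B (S i)) z :=
    fun i z hz => not_transGen_pseudoJoinSource hz
  have hjump : ∀ i {a b}, pseudoJoinSource A B (S i) = b → a ∈ (S i).1 → a < b → _ :=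
    fun i a b => transGen_or_jump (a := a) (b := b) hℍ hA hB (K := S i)
  have hbd := fun i => hℍ.bounds _ (S i).2 _ (hmem i)
  have hsucc := hS.mem_succ
  have hlast := hS.mem_last
  have hnot := hS.not_mem
  clear hS
  generalize hx : (fun i => pseudoJoinSource A B (S i)) = x at *
  have hx' : ∀ i, pseudoJoinSource A B (S i) = x i := fun i => congrFun hx i
  simp only [hx'] at *
  have hreach : ∀ i, i + 1 < k → Relation.TransGen (JoinStep A B) (x (i + 1)) (x i) := by
    intro i hi
    rcases hjump i rfl (hsucc i hi) (hanti _ _ (by omega) hi) with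
      h | ⟨u, v, z, N, hau, hub, hbv, hvz, hz, hvK, hbN, huN, hNv, hvz', -⟩
    · exact h
    exfalso
    have hle : x (k - 1) ≤ x i := (hanti i (k - 1) (by omega) (by omega)).le
    have h1 := hℍ.below _ (S i).2 (x i) v z (hmem i) hz hvK hbv hvz _ (hbd (k - 1)).1 hle
    have hik : i + 1 = k - 1 := by
      by_contra hne
      exact hnot i (k - 1) (by omega) (by omega) (by omega) (by omega) (by omega) h1
    have h0 := hnot i 0 (by omega) (by omega) (by omega) (by omega) (by omega)
    have hz0 : x 0 < z := by
      by_contra h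
      exact h0 (hℍ.above _ (S i).2 (x i) v z (hmem i) hz hvK hbv hvz _ (not_lt.1 h) (hbd 0).2)
    have h2 := hℍ.above _ (S (k - 1)).2 (x (k - 1)) (x 1) (x 0) (hmem _) hlast
      (hnot _ _ (by omega) (by omega) (by omega) (by omega) (by omega))
      (hanti _ _ (by omega) (by omega)) (hanti _ _ (by omega) (by omega)) z hz0.le
      (hℍ.bounds _ (S i).2 z hz).2
    rw [hik] at hau
    exact hcl _ z h2 (Relation.TransGen.trans_right hau
      (Relation.TransGen.head' ⟨by omega, N, huN, hNv⟩ hvz'))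
  have hall : ∀ i, i + 1 < k → Relation.TransGen (JoinStep A B) (x (i + 1)) (x 0) := by
    intro i
    induction i with
    | zero => exact hreach 0
    | succ i ih => exact fun hi => (hreach _ hi).trans (ih (by omega))
  have h1 := hall (k - 2) (by omega)
  rw [show k - 2 + 1 = k - 1 by omega] at h1
  exact hcl _ _ hlast h1

/-- The first source leads to the last by a chain; let `J`, with source `q`, be its step across the
source of `S (k - 2)`. Going backwards, every `σ (S i)` outranks `q`, so it avoids `J`, which
contains all vertices up to `x 0`. Hence `σ (S 0) > x 0`, which is absurd. -/
theorem not_isChordlessCycle_of_increasing (hℍ : IsArcFamily n ℍ) (hA : A.IsAcyclic)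
    (hB : B.IsAcyclic) {k : ℕ} (hk : 3 ≤ k) {S : ℕ → {H // H ∈ ℍ}}
    (hS : IsChordlessCycle (pseudoJoinSource A B) k S)
    (hmono : ∀ i j, i < j → j < k → pseudoJoinSource A B (S i) < pseudoJoinSource A B (S j)) :
    False := by
  have hmem := fun i => pseudoJoinSource_mem A B (S i)
  have hcl : ∀ i, ∀ z ∈ (S i).1,
      ¬ Relation.TransGen (JoinStep A B) (pseudoJoinSource A B (S i)) z :=
    fun i z hz => not_transGen_pseudoJoinSource hz
  have hM : ∀ i, maxSource A B (S i) ≤ pseudoJoinSource A B (S i) :=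
    fun i => maxSource_le_pseudoJoinSource A B (S i)
  have hjump : ∀ i {a b}, pseudoJoinSource A B (S i) = b → a ∈ (S i).1 → a < b → _ :=
    fun i a b => transGen_or_jump (a := a) (b := b) hℍ hA hB (K := S i)
  have hbd := fun i => hℍ.bounds _ (S i).2 _ (hmem i)
  have hsucc := hS.mem_succ
  have hlast := hS.mem_last
  have hnot := hS.not_mem
  clear hS
  generalize hx : (fun i => pseudoJoinSource A B (S i)) = x at *
  have hx' : ∀ i, pseudoJoinSource A B (S i) = x i := fun i => congrFun hx i
  simp only [hx'] at *
  have hreach : Relation.TransGen (JoinStep A B) (x 0) (x (k - 1)) := by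
    rcases hjump (k - 1) rfl hlast (hmono _ _ (by omega) (by omega)) with
      h | ⟨u, v, z, N, hau, hub, hbv, hvz, hz, hvK, hbN, huN, hNv, hvz', -⟩
    · exact h
    exact absurd (hℍ.above _ (S (k - 1)).2 (x 0) (x 1) (x (k - 1)) hlast (hmem _)
      (hnot _ _ (by omega) (by omega) (by omega) (by omega) (by omega))
      (hmono _ _ (by omega) (by omega)) (hmono _ _ (by omega) (by omega)) v hbv.le
      (by rw [← hNv]; exact (hℍ.bounds _ N.2 _ (maxSource_mem A B N)).2)) hvK
  obtain ⟨p, q, hp, ⟨hpq, J, hpJ, hJq⟩, hq, hpw, hwq⟩ := JoinStep.exists_crossing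
    (w := x (k - 2)) hreach.to_reflTransGen (hmono _ _ (by omega) (by omega)).le
    (hmono _ _ (by omega) (by omega))
  have hp' := JoinStep.le_of_reflTransGen hp
  have hq' := JoinStep.le_of_reflTransGen hq
  have hqJ : q ∈ J.1 := hJq ▸ maxSource_mem A B J
  have hmem' : x (k - 1) ∈ (S (k - 2)).1 := by
    have := hsucc (k - 2) (by omega)
    rwa [show k - 2 + 1 = k - 1 by omega] at this
  have hqS : q ∈ (S (k - 2)).1 := by
    by_contra h
    have hne : q ≠ x (k - 1) := fun he => h (he ▸ hmem')
    exact hnot (k - 2) 0 (by omega) (by omega) (by omega) (by omega) (by omega)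
      (hℍ.below _ (S (k - 2)).2 _ q _ (hmem _) hmem' h hwq (by omega) _ (hbd 0).1
        (hmono _ _ (by omega) (by omega)).le)
  have hwJ : x (k - 2) ∉ J.1 := fun h => hcl _ q hqS (.single ⟨hwq, J, h, hJq⟩)
  have hpw' : p < x (k - 2) := lt_of_le_of_ne hpw fun h => hwJ (h ▸ hpJ)
  have hJbelow := hℍ.below _ J.2 p _ q hpJ hqJ hwJ hpw' hwq
  obtain ⟨σ, r, hσ, hσle, hσJ⟩ := exists_isRanking_maxSource hA hB J
  rw [hJq] at hσJ
  have hlow : ∀ i, r q < r (σ (S i)) → x 0 < σ (S i) := by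
    intro i hi
    by_contra h
    have h1 := hJbelow _ (hℍ.bounds _ (S i).2 _ (hσ.mem _)).1 (by omega)
    have h2 := hσ.lt J _ h1 (by rw [hσJ]; intro he; rw [he] at hi; omega)
    rw [hσJ] at h2
    omega
  have hle : ∀ i, σ (S i) ≤ x i := fun i => (hσle _).trans (hM i)
  have key : ∀ d, d ≤ k - 2 → r q < r (σ (S (k - 2 - d))) := by
    intro d
    induction d with
    | zero =>
      intro _
      have := hle (k - 2)
      exact hσ.lt _ q hqS (by simp only [Nat.sub_zero]; omega)
    | succ d ih =>
      intro hd
      have hc := ih (by omega)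
      obtain ⟨i, hi⟩ : ∃ i, k - 2 - d = i + 1 := ⟨k - 2 - d - 1, by omega⟩
      rw [show k - 2 - (d + 1) = i by omega]
      rw [hi] at hc
      have hc0 := hlow _ hc
      have hcle := hle (i + 1)
      have hcm := hσ.mem (S (i + 1))
      have hci : x i < σ (S (i + 1)) := by
        by_contra h
        have hnm := hnot (i + 1) i (by omega) (by omega) (by omega) (by omega) (by omega)
        have hne : σ (S (i + 1)) ≠ x i := fun he => hnm (he ▸ hcm)
        exact hnot (i + 1) 0 (by omega) (by omega) (by omega) (by omega) (by omega)
          (hℍ.below _ (S (i + 1)).2 _ _ _ hcm (hmem _) hnm (by omega)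
            (hmono _ _ (by omega) (by omega)) _ (hbd 0).1 hc0.le)
      have hcS : σ (S (i + 1)) ∈ (S i).1 := by
        by_contra h
        have hne : σ (S (i + 1)) ≠ x (i + 1) := fun he => h (he ▸ hsucc i (by omega))
        exact hnot i (k - 1) (by omega) (by omega) (by omega) (by omega) (by omega)
          (hℍ.above _ (S i).2 _ _ _ (hmem i) (hsucc i (by omega)) h hci (by omega) _
            (hmono _ _ (by omega) (by omega)).le (hbd _).2)
      have := hle i
      exact hc.trans (hσ.lt _ _ hcS (by omega))
  have h0 := key (k - 2) le_rfl
  rw [Nat.sub_self] at h0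
  have h1 := hlow 0 h0
  have h2 := hle 0
  omega

/-- The last hyperedge misses the source before it, so it contains everything above `x 0`;
chordlessness makes `x 0` the maximum. A later failure of decrease would make some `S i` contain
everything below its successor's source, including the minimum. -/
theorem not_isChordlessCycle_of_max_first (hℍ : IsArcFamily n ℍ) (hA : A.IsAcyclic)
    (hB : B.IsAcyclic) {k : ℕ} (hk : 3 ≤ k) {S : ℕ → {H // H ∈ ℍ}}
    (hS : IsChordlessCycle (pseudoJoinSource A B) k S)
    (hmin : ∀ j < k - 1, pseudoJoinSource A B (S (k - 1)) < pseudoJoinSource A B (S j))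
    (hlt : pseudoJoinSource A B (S (k - 2)) < pseudoJoinSource A B (S 0)) : False := by
  have hmem := fun i => pseudoJoinSource_mem A B (S i)
  have hbd := fun i => hℍ.bounds _ (S i).2 _ (hmem i)
  have hmax : ∀ j, 0 < j → j < k → pseudoJoinSource A B (S j) < pseudoJoinSource A B (S 0) := by
    intro j h0 hj
    by_contra h
    have hne : j ≠ k - 1 := by
      rintro rfl
      exact h (hmin 0 (by omega))
    exact hS.not_mem (k - 1) j (by omega) hj hne (by omega) (by omega)
      (hℍ.above _ (S (k - 1)).2 _ _ _ (hmem _) hS.mem_last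
        (hS.not_mem (k - 1) (k - 2) (by omega) (by omega) (by omega) (by omega) (by omega))
        (hmin _ (by omega)) hlt _ (not_lt.1 h) (hbd j).2)
  refine not_isChordlessCycle_of_decreasing hℍ hA hB hk hS fun i => ?_
  induction i with
  | zero => exact hmax
  | succ i ih =>
    intro j hij hj
    by_contra h
    have hnm := hS.not_mem i j (by omega) hj (by omega) (by omega) (by omega)
    have hm := hS.mem_succ i (by omega)
    have hne : pseudoJoinSource A B (S (i + 1)) ≠ pseudoJoinSource A B (S j) :=
      fun he => hnm (he ▸ hm)
    exact hS.not_mem i (k - 1) (by omega) (by omega) (by omega) (by omega) (by omega)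
      (hℍ.below _ (S i).2 _ _ _ hm (hmem i) hnm (by omega) (ih j (by omega) hj) _
        (hbd _).1 (hmin _ (by omega)).le)

theorem not_isChordlessCycle_of_max_last (hℍ : IsArcFamily n ℍ) (hA : A.IsAcyclic)
    (hB : B.IsAcyclic) {k : ℕ} (hk : 3 ≤ k) {S : ℕ → {H // H ∈ ℍ}}
    (hS : IsChordlessCycle (pseudoJoinSource A B) k S)
    (hmin : ∀ j, 0 < j → j < k → pseudoJoinSource A B (S 0) < pseudoJoinSource A B (S j))
    (hlt : pseudoJoinSource A B (S 1) < pseudoJoinSource A B (S (k - 1))) : False := by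
  have hmem := fun i => pseudoJoinSource_mem A B (S i)
  have hbd := fun i => hℍ.bounds _ (S i).2 _ (hmem i)
  have hmax : ∀ j, j < k - 1 →
      pseudoJoinSource A B (S j) < pseudoJoinSource A B (S (k - 1)) := by
    intro j hj
    by_contra h
    have hne : j ≠ 0 := by
      rintro rfl
      exact h (hmin _ (by omega) (by omega))
    exact hS.not_mem (k - 1) j (by omega) (by omega) (by omega) (by omega) (by omega)
      (hℍ.above _ (S (k - 1)).2 _ _ _ hS.mem_last (hmem _)
        (hS.not_mem (k - 1) 1 (by omega) (by omega) (by omega) (by omega) (by omega))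
        (hmin _ (by omega) (by omega)) hlt _ (not_lt.1 h) (hbd j).2)
  refine not_isChordlessCycle_of_increasing hℍ hA hB hk hS fun i => ?_
  induction i with
  | zero => exact hmin
  | succ i ih =>
    intro j hij hj
    by_contra h
    have hnm := hS.not_mem i j (by omega) hj (by omega) (by omega) (by omega)
    have hm := hS.mem_succ i (by omega)
    have hne : pseudoJoinSource A B (S (i + 1)) ≠ pseudoJoinSource A B (S j) :=
      fun he => hnm (he ▸ hm)
    exact hS.not_mem i (k - 1) (by omega) (by omega) (by omega) (by omega) (by omega)
      (hℍ.above _ (S i).2 _ _ _ (hmem i) hm hnm (ih j (by omega) hj) (by omega) _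
        (hmax _ (by omega)).le (hbd _).2)

theorem isAcyclic_pseudoJoin (hℍ : IsArcFamily n ℍ)
    (hfix : ∀ x y : ℕ, 1 ≤ x → x < y → y ≤ n → ∀ I Icyc J Jcyc : Finset ℕ,
      IsHuggingQuadruple x y (restriction ℍ (Finset.Icc x y)) I Icyc J Jcyc →
        ∃ H, IsFix x y (restriction ℍ (Finset.Icc x y)) I Icyc J Jcyc H)
    (hA : A.IsAcyclic) (hB : B.IsAcyclic) : (pseudoJoin A B).IsAcyclic := by
  classical
  rintro ⟨k₀, S₀, hS₀⟩
  have hex : ∃ k, 0 < k ∧ ∃ S, IsSourceCycle (pseudoJoinSource A B) k S := by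
    refine ⟨k₀ + 2, by omega, fun i => S₀ (Fin.ofNat (k₀ + 2) i), fun i => ?_, fun i => ?_⟩
    · congr 1
      exact Fin.ext (by simp)
    · have h := hS₀ (Fin.ofNat (k₀ + 2) i)
      rw [Finset.mem_sdiff, Finset.mem_singleton] at h
      have he : Fin.ofNat (k₀ + 2) (i + 1) = Fin.ofNat (k₀ + 2) i + 1 :=
        Fin.ext (by simp [Fin.val_add])
      rw [he]
      exact h
  obtain ⟨hk, S, hS⟩ := Nat.find_spec hex
  have hmin : ∀ k' < Nat.find hex, 0 < k' → ∀ T,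
      ¬ IsSourceCycle (pseudoJoinSource A B) k' T :=
    fun k' h1 h2 T hT => Nat.find_min hex h1 ⟨h2, T, hT⟩
  generalize Nat.find hex = k at hk hS hmin
  -- Rotate the cycle so that it starts at its least source.
  obtain ⟨m, -, hm⟩ := Finset.exists_min_image (Finset.range k)
    (fun i => pseudoJoinSource A B (S i)) ⟨0, Finset.mem_range.2 hk⟩
  have hper : ∀ i, S i = S (i % k) := by
    intro i
    conv_lhs => rw [← Nat.mod_add_div i k]
    generalize i / k = q
    induction q with
    | zero => rfl
    | succ q ih => rw [mul_add, mul_one, ← add_assoc, hS.periodic, ih]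
  have hm' : ∀ i, pseudoJoinSource A B (S m) ≤ pseudoJoinSource A B (S i) := by
    intro i
    rw [hper i]
    exact hm _ (Finset.mem_range.2 (Nat.mod_lt _ hk))
  have hT := hS.shift m
  have hT0 : ∀ i, pseudoJoinSource A B (S (0 + m)) ≤ pseudoJoinSource A B (S (i + m)) := by
    intro i
    rw [zero_add]
    exact hm' _
  generalize hTS : (fun i => S (i + m)) = T at hT
  have hTS' : ∀ i, S (i + m) = T i := fun i => congrFun hTS i
  simp only [hTS'] at hT0
  clear hTS hTS' hm hm' hper hS
  have hs0 := hT.step 0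
  have hs1 := hT.step 1
  rcases Nat.lt_or_ge k 3 with hk3 | hk3
  · obtain rfl | rfl : k = 1 ∨ k = 2 := by omega
    · rw [hT.periodic] at hs0
      exact hs0.2 rfl
    · have h2 := hT.periodic 0
      rw [show 1 + 1 = 0 + 2 from rfl, h2] at hs1
      exact no_mutual_source_step hℍ hfix hA hB rfl rfl
        (lt_of_le_of_ne (hT0 1) hs0.2.symm) hs1.1 hs0.1
  have hC := hT.isChordlessCycle hk hmin
  have hlt : ∀ j, 0 < j → j < k →
      pseudoJoinSource A B (T 0) < pseudoJoinSource A B (T j) := by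
    intro j h0 hj
    refine lt_of_le_of_ne (hT0 j) fun he => ?_
    rcases Nat.lt_or_ge 1 j with h1 | h1
    · exact hC.not_mem 0 j hk hj (by omega) (by omega) (by omega)
        (he ▸ pseudoJoinSource_mem A B (T 0))
    · obtain rfl : j = 1 := by omega
      exact hs0.2 he.symm
  rcases lt_trichotomy (pseudoJoinSource A B (T 1)) (pseudoJoinSource A B (T (k - 1))) with
    h | h | h
  · exact not_isChordlessCycle_of_max_last hℍ hA hB hk3 hC hlt h
  · exact hC.not_mem 0 (k - 1) hk (by omega) (by omega) (by omega) (by omega) (h ▸ hs0.1)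
  -- Shifting by one puts the least source last.
  · refine not_isChordlessCycle_of_max_first hℍ hA hB hk3
      ((hT.shift 1).isChordlessCycle hk hmin) (fun j hj => ?_) ?_
    · rw [show k - 1 + 1 = 0 + k by omega, hT.periodic]
      exact hlt _ (by omega) (by omega)
    · rwa [show k - 2 + 1 = k - 1 by omega]

end HyperOrientation

theorem proposition5p11 (n : ℕ) (ℍ : Finset (Finset ℕ))
    (hℍ : IsCyclicIntervalHypergraph 1 n ℍ)
    (hreg : ∀ x y : ℕ, 1 ≤ x → x < y → y ≤ n →
      ClosedUnderIntersection (regularPart x y (restriction ℍ (Finset.Icc x y))))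
    (hfix : ∀ x y : ℕ, 1 ≤ x → x < y → y ≤ n → ∀ I Icyc J Jcyc : Finset ℕ,
      IsHuggingQuadruple x y (restriction ℍ (Finset.Icc x y)) I Icyc J Jcyc →
        ∃ H, IsFix x y (restriction ℍ (Finset.Icc x y)) I Icyc J Jcyc H)
    (A B : AcyclicOrientation ℍ) (hAB : ¬ A ≤ B) (hBA : ¬ B ≤ A) :
    ∃ hX : (HyperOrientation.pseudoJoin A.1 B.1).IsAcyclic,
      IsLUB {A, B} (⟨HyperOrientation.pseudoJoin A.1 B.1, hX⟩ : AcyclicOrientation ℍ) := by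
  have harc := hℍ.isArcFamily
  refine ⟨HyperOrientation.isAcyclic_pseudoJoin harc hfix A.2 B.2, ?_, fun C hC H => ?_⟩
  · rintro C (rfl | rfl) H
    · exact (le_max_left _ _).trans (HyperOrientation.maxSource_le_pseudoJoinSource _ _ H)
    · exact (le_max_right _ _).trans (HyperOrientation.maxSource_le_pseudoJoinSource _ _ H)
  · have hA : A ≤ C := hC (Or.inl rfl)
    have hB : B ≤ C := hC (Or.inr rfl)
    exact HyperOrientation.pseudoJoinSource_le harc hreg A.2 B.2 C.2
      (fun K => max_le (hA K) (hB K)) H
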